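/- Let $k,r$ be integers with $1<r<k$ and $\gcd(r,k)=1$, and put $n=2k$. Regard $\mathbb{F}_{2^k}$ as the subfield of $\mathbb{F}_{2^n}$ with $2^k$ elements, and let $\mathrm{Tr}^m_1:\mathbb{F}_{2^m}\to\mathbb{F}_2$ denote the absolute trace. Let $$G(x)=\sum_{i=1}^{2^r-1}x^{(i2^{k-r}+1)(2^k-1)+1},\qquad x\in\mathbb{F}_{2^n}.$$ Then $G(x)\in\mathbb{F}_{2^k}$ for every $x\in\mathbb{F}_{2^n}$. Let $\{u_1,\dots,u_k\}$ be a basis of $\mathbb{F}_{2^k}$ over $\mathbb{F}_2$, let $i_1,\dots,i_\tau\in\{1,\dots,k\}$ be pairwise distinct, and let $F\in\mathbb{F}_2[X_1,\dots,X_\tau]$ be a reduced polynomial, that is, one in which every variable occurs with exponent at most $1$ in each monomial. Then the function $H:\mathbb{F}_{2^n}\to\mathbb{F}_{2^k}$, $$H(x)=G(x)+F\big(\mathrm{Tr}^n_1(u_{i_1}x),\dots,\mathrm{Tr}^n_1(u_{i_\tau}x)\big),$$ is vectorial bent, that is, for every $\lambda\in\mathbb{F}_{2^k}\setminus\{0\}$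 and every $a\in\mathbb{F}_{2^n}$, $$\Big|\sum_{x\in\mathbb{F}_{2^n}}(-1)^{\mathrm{Tr}^k_1(\lambda H(x))+\mathrm{Tr}^n_1(ax)}\Big|=2^{n/2}.$$ Furthermore, if $F$ has degree $k$ and the algebraic degree of $G:\mathbb{F}_{2^n}\to\mathbb{F}_{2^k}$ is not equal to $k$, then $H$ has algebraic degree $k$. Here the algebraic degree of a function $\mathbb{F}_{2^n}\to\mathbb{F}_{2^k}$ is the largest degree of the reduced polynomials in $\mathbb{F}_2[X_1,\dots,X_n]$ that represent its $k$ coordinate functions, after identifying $\mathbb{F}_{2^n}$ with $\mathbb{F}_2^n$ and $\mathbb{F}_{2^k}$ with $\mathbb{F}_2^k$ by any $\mathbb{F}_2$-bases. -/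

import Mathlib

/-- `χ(b) = (-1)^b` for `b ∈ 𝔽₂`. -/
def boolSign (b : ZMod 2) : ℤ := (-1) ^ b.val

/-- The Walsh transform `W_f(a) = ∑ₓ (-1)^(f(x) + Tr(a x))` of a Boolean function on a finite field
`K` of characteristic two. -/
noncomputable def walsh {K : Type*} [Field K] [Fintype K] [Algebra (ZMod 2) K]
    (f : K → ZMod 2) (a : K) : ℤ :=
  ∑ x : K, boolSign (f x + Algebra.trace (ZMod 2) K (a * x))

/-- `f` is bent: `|W_f(a)| = 2^(n/2)` for all `a`, where `n = [K : 𝔽₂]`. -/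
def IsBent {K : Type*} [Field K] [Fintype K] [Algebra (ZMod 2) K] (f : K → ZMod 2) : Prop :=
  ∀ a : K, |(walsh f a : ℝ)| = (2 : ℝ) ^ ((Module.finrank (ZMod 2) K : ℝ) / 2)

/-- The component `x ↦ Tr(c H(x))` of a function `H : K → L`. -/
noncomputable def component {K L : Type*} [Field L] [Algebra (ZMod 2) L]
    (H : K → L) (c : L) : K → ZMod 2 :=
  fun x => Algebra.trace (ZMod 2) L (c * H x)

/-- `H : K → L` is vectorial bent: all components at nonzero elements of `L` are bent. -/
def IsVectorialBent {K L : Type*} [Field K] [Fintype K] [Algebra (ZMod 2) K]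
    [Field L] [Algebra (ZMod 2) L] (H : K → L) : Prop :=
  ∀ c : L, c ≠ 0 → IsBent (component H c)

/-- Reduced polynomials over `𝔽₂`: every variable occurs with exponent at most one. -/
def IsReducedPoly {σ : Type} (P : MvPolynomial σ (ZMod 2)) : Prop :=
  ∀ j, P.degreeOf j ≤ 1

theorem isReducedPoly_iff {σ : Type} (P : MvPolynomial σ (ZMod 2)) :
    IsReducedPoly P ↔ P ∈ MvPolynomial.restrictDegree σ (ZMod 2) (Fintype.card (ZMod 2) - 1) := by
  classical
  rw [MvPolynomial.mem_restrictDegree_iff_sup]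
  simp [IsReducedPoly, MvPolynomial.degreeOf_def, ZMod.card]

/-- Every function `𝔽₂^σ → 𝔽₂` is represented by exactly one reduced polynomial. -/
theorem existsUnique_anf {σ : Type} [Finite σ] (f : (σ → ZMod 2) → ZMod 2) :
    ∃! P : MvPolynomial σ (ZMod 2), IsReducedPoly P ∧ ∀ v, MvPolynomial.eval v P = f v := by
  have h := MvPolynomial.map_restrict_dom_evalₗ (K := ZMod 2) (σ := σ)
  have hf : f ∈ (⊤ : Submodule (ZMod 2) ((σ → ZMod 2) → ZMod 2)) := trivial
  rw [← h] at hf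
  obtain ⟨P, hP, hPf⟩ := hf
  have hPf' : ∀ v, MvPolynomial.eval v P = f v := fun v => by rw [← hPf]; rfl
  refine ⟨P, ⟨(isReducedPoly_iff P).2 hP, hPf'⟩, ?_⟩
  rintro Q ⟨hQ, hQf⟩
  refine sub_eq_zero.1 (MvPolynomial.eq_zero_of_eval_eq_zero σ (ZMod 2) (Q - P) ?_ ?_)
  · intro v
    rw [map_sub, hQf, hPf', sub_self]
  · exact Submodule.sub_mem _ ((isReducedPoly_iff Q).1 hQ) hP

/-- The algebraic normal form of a Boolean function in the variables indexed by `σ`. -/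
noncomputable def anf {σ : Type} [Finite σ] (f : (σ → ZMod 2) → ZMod 2) :
    MvPolynomial σ (ZMod 2) :=
  (existsUnique_anf f).choose

theorem anf_spec {σ : Type} [Finite σ] (f : (σ → ZMod 2) → ZMod 2) :
    IsReducedPoly (anf f) ∧ ∀ v, MvPolynomial.eval v (anf f) = f v :=
  (existsUnique_anf f).choose_spec.1

/-- The algebraic degree of `H : K → L`, where `K` and `L` are identified with `𝔽₂^σ` and `𝔽₂^ρ` by
the bases `b` and `c`: the largest degree of the algebraic normal forms of the coordinate functions
of `H`. -/
noncomputable def algDegree {K L : Type*} [Field K] [Algebra (ZMod 2) K]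
    [Field L] [Algebra (ZMod 2) L] {σ ρ : Type} [Finite σ] [Fintype ρ]
    (b : Module.Basis σ (ZMod 2) K) (c : Module.Basis ρ (ZMod 2) L) (H : K → L) : ℕ :=
  Finset.univ.sup fun j : ρ =>
    (anf fun v : σ → ZMod 2 => c.repr (H (b.equivFun.symm v)) j).totalDegree

/-- The sum `∑_{i=1}^{2^r-1} x^((i 2^(k-r) + 1)(2^k - 1) + 1)` of Niho type, for `r ≤ k`. -/
def nihoSum {K : Type*} [Field K] (k r : ℕ) (x : K) : K :=
  ∑ i ∈ Finset.Icc 1 (2 ^ r - 1), x ^ ((i * 2 ^ (k - r) + 1) * (2 ^ k - 1) + 1)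

/-!
Write `q = 2^(k-r)`, let `tr` be the trace of the quadratic extension `K / L`, choose `θ ∈ K` with
`tr θ = 1`, and use the coordinates `(s, y) ∈ L²` of `x = s + y θ`, so that `y = tr x`
(`quadCoord`). Writing the terms of the Niho sum as `A^i B^(2^r-i)` with `B = x^q` and `A` its
conjugate, the geometric series gives `y^q G(x) = tr(x^(q+1))` (`nihoSum_mul`), and expanding this
trace gives
`G(s + y θ) = s + (y^(2^r-1) s)^q + tr(θ^(q+1)) y` (`nihoSum_eq`). In particular `G` has values
in `L`.

*Bentness.* By Frobenius invariance of the trace,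
`Tr(c G(x)) = Tr(s (c + c^(2^r) y^(2^r-1))) + Tr(c tr(θ^(q+1)) y)`. Since `r` is coprime to `k`,
the map `y ↦ c + c^(2^r) y^(2^r-1)` permutes `L`, so the component is a Maiorana–McFarland
function. As `Tr(u x) = Tr(u y)` for `u ∈ L`, adding a function of the traces `Tr(u_{i_j} x)`
only changes the part which depends on `y` alone, so the components of `H` are again of this type
and hence bent (`isBent_maioranaMcFarland`).

*Degree.* `y^(2^r-1) s` is a product of `r + 1` linear maps, so every coordinate of `G` has degree
at most `r + 1 ≤ k`, and less than `k` if the algebraic degree of `G` is not `k`. The linear forms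
`Tr(u_{i_j} x)` are independent, so `F` composed with them keeps its degree `k`
(`totalDegree_le_of_comp_mem_degreeLE`), and it occurs in a coordinate of `H` at which `1 ∈ L` has
a nonzero coordinate. Degrees are compared by means of the coordinate-free spaces `degreeLE`.
-/

/-! ### Polynomial degree of Boolean functions on a vector space -/

/-- The functions `V → 𝔽₂` of algebraic degree at most `d`, described without coordinates: the
span of the products of at most `d` linear functionals. -/
def degreeLE (V : Type*) [AddCommGroup V] [Module (ZMod 2) V] (d : ℕ) :
    Submodule (ZMod 2) (V → ZMod 2) :=
  Submodule.span (ZMod 2)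
    {f | ∃ l : List (V →ₗ[ZMod 2] ZMod 2), l.length ≤ d ∧ f = fun x => (l.map (· x)).prod}

section degreeLE

variable {V W : Type*} [AddCommGroup V] [Module (ZMod 2) V] [AddCommGroup W] [Module (ZMod 2) W]

theorem list_prod_mem_degreeLE {d : ℕ} (l : List (V →ₗ[ZMod 2] ZMod 2)) (hl : l.length ≤ d) :
    (fun x => (l.map (· x)).prod) ∈ degreeLE V d :=
  Submodule.subset_span ⟨l, hl, rfl⟩

theorem degreeLE_mono {d e : ℕ} (h : d ≤ e) : degreeLE V d ≤ degreeLE V e :=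
  Submodule.span_mono fun _ ⟨l, hl, hf⟩ => ⟨l, hl.trans h, hf⟩

theorem linear_mem_degreeLE (T : V →ₗ[ZMod 2] ZMod 2) : (fun x => T x) ∈ degreeLE V 1 := by
  simpa using list_prod_mem_degreeLE (d := 1) [T] (by simp)

theorem linear_mul_mem_degreeLE {d : ℕ} {f : V → ZMod 2} (T : V →ₗ[ZMod 2] ZMod 2)
    (hf : f ∈ degreeLE V d) : (fun x => T x * f x) ∈ degreeLE V (d + 1) := by
  induction hf using Submodule.span_induction with
  | mem f hf =>
    obtain ⟨l, hl, rfl⟩ := hf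
    simpa using list_prod_mem_degreeLE (d := d + 1) (T :: l) (by simpa using hl)
  | zero =>
    convert (degreeLE V (d + 1)).zero_mem using 1
    ext x; simp
  | add f g _ _ hf hg =>
    convert (degreeLE V (d + 1)).add_mem hf hg using 1
    ext x; simp [mul_add]
  | smul a f _ hf =>
    convert (degreeLE V (d + 1)).smul_mem a hf using 1
    ext x; simp [mul_left_comm]

theorem comp_mem_degreeLE {d : ℕ} {f : W → ZMod 2} (A : V →ₗ[ZMod 2] W)
    (hf : f ∈ degreeLE W d) : (fun x => f (A x)) ∈ degreeLE V d := by
  induction hf using Submodule.span_induction with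
  | mem f hf =>
    obtain ⟨l, hl, rfl⟩ := hf
    simpa [Function.comp_def] using
      list_prod_mem_degreeLE (d := d) (l.map fun T => T.comp A) (by simpa using hl)
  | zero => exact (degreeLE V d).zero_mem
  | add f g _ _ hf hg => exact (degreeLE V d).add_mem hf hg
  | smul a f _ hf => exact (degreeLE V d).smul_mem a hf

/-- Multiplying a vector-valued function by a linear map raises the degree of its linear
coordinates by at most one: expand the linear map in a basis of the target algebra. -/
theorem linear_mul_comp_mem_degreeLE {L : Type*} [Field L] [Algebra (ZMod 2) L]
    [FiniteDimensional (ZMod 2) L] {d : ℕ} {g : V → L} (A : V →ₗ[ZMod 2] L)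
    (hg : ∀ T : L →ₗ[ZMod 2] ZMod 2, (fun x => T (g x)) ∈ degreeLE V d)
    (T : L →ₗ[ZMod 2] ZMod 2) : (fun x => T (A x * g x)) ∈ degreeLE V (d + 1) := by
  let e := Module.finBasis (ZMod 2) L
  have h : (fun x => T (A x * g x)) =
      ∑ i, fun x => (e.coord i ∘ₗ A) x * (T ∘ₗ LinearMap.mulLeft (ZMod 2) (e i)) (g x) := by
    ext x
    have hx : A x * g x = ∑ i, e.repr (A x) i • (e i * g x) := by
      conv_lhs => rw [← e.sum_repr (A x), Finset.sum_mul]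
      simp only [smul_mul_assoc]
    simp [hx, Finset.sum_apply]
  rw [h]
  exact Submodule.sum_mem _ fun i _ => linear_mul_mem_degreeLE _ (hg _)

theorem eval_mem_degreeLE {σ : Type} {d : ℕ} {P : MvPolynomial σ (ZMod 2)}
    (hP : P.totalDegree ≤ d) : (fun v => MvPolynomial.eval v P) ∈ degreeLE (σ → ZMod 2) d := by
  have h : (fun v => MvPolynomial.eval v P) = ∑ m ∈ P.support, P.coeff m • fun v : σ → ZMod 2 =>
      (((Finsupp.toMultiset m).toList.map fun i =>
        (LinearMap.proj i : (σ → ZMod 2) →ₗ[ZMod 2] ZMod 2)).map (· v)).prod := by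
    ext v
    rw [MvPolynomial.eval_eq]
    simp only [Finset.sum_apply, Pi.smul_apply, smul_eq_mul, List.map_map]
    refine Finset.sum_congr rfl fun m _ => ?_
    rw [← Multiset.prod_coe, ← Multiset.map_coe, Multiset.coe_toList, Finsupp.toMultiset_map,
      Finsupp.prod_toMultiset, Finsupp.prod_mapDomain_index (by simp) (fun _ _ _ => pow_add _ _ _)]
    rfl
  rw [h]
  refine Submodule.sum_mem _ fun m hm => Submodule.smul_mem _ _ (list_prod_mem_degreeLE _ ?_)
  simpa [Finsupp.card_toMultiset] using! (MvPolynomial.le_totalDegree hm).trans hP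

theorem exists_eval_of_mem_degreeLE {σ : Type} [Fintype σ] {d : ℕ} {f : (σ → ZMod 2) → ZMod 2}
    (hf : f ∈ degreeLE (σ → ZMod 2) d) : ∃ P : MvPolynomial σ (ZMod 2),
      P.totalDegree ≤ d ∧ ∀ v, MvPolynomial.eval v P = f v := by
  classical
  induction hf using Submodule.span_induction with
  | mem f hf =>
    obtain ⟨l, hl, rfl⟩ := hf
    refine ⟨(l.map fun T => ∑ i, MvPolynomial.C (T (Pi.single i 1)) * MvPolynomial.X i).prod,
      (MvPolynomial.totalDegree_list_prod _).trans (le_trans ?_ hl), fun v => ?_⟩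
    · rw [List.map_map]
      refine (List.sum_le_card_nsmul _ 1 ?_).trans (by simp)
      simp only [List.mem_map, Function.comp_apply, forall_exists_index, and_imp]
      rintro _ T _ rfl
      refine MvPolynomial.totalDegree_finsetSum_le fun i _ => ?_
      exact (MvPolynomial.totalDegree_mul _ _).trans (by simp)
    · rw [map_list_prod, List.map_map]
      congr 1
      refine List.map_congr_left fun T _ => ?_
      rw [T.pi_apply_eq_sum_univ v]
      simp only [Function.comp_apply, map_sum, map_mul, MvPolynomial.eval_C, MvPolynomial.eval_X,
        smul_eq_mul]
      refine Finset.sum_congr rfl fun i _ => ?_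
      rw [mul_comm]
      congr 2
      ext j
      simp [Pi.single_apply, eq_comm]
  | zero => exact ⟨0, by simp, by simp⟩
  | add f g _ _ hf hg =>
    obtain ⟨P, hP, hPf⟩ := hf
    obtain ⟨Q, hQ, hQg⟩ := hg
    exact ⟨P + Q, (MvPolynomial.totalDegree_add P Q).trans (max_le hP hQ), by simp [hPf, hQg]⟩
  | smul a f _ hf =>
    obtain ⟨P, hP, hPf⟩ := hf
    exact ⟨a • P, (MvPolynomial.totalDegree_smul_le a P).trans hP, by simp [hPf]⟩

theorem anf_eq {σ : Type} [Finite σ] {P : MvPolynomial σ (ZMod 2)} (hP : IsReducedPoly P)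
    {f : (σ → ZMod 2) → ZMod 2} (h : ∀ v, MvPolynomial.eval v P = f v) : anf f = P :=
  (existsUnique_anf f).unique (anf_spec f) ⟨hP, h⟩

/-- Passing to the algebraic normal form does not raise the degree: replacing every positive
exponent by `1` does not change the values over `𝔽₂`. -/
theorem totalDegree_anf_eval_le {σ : Type} [Finite σ] (P : MvPolynomial σ (ZMod 2)) :
    (anf fun v => MvPolynomial.eval v P).totalDegree ≤ P.totalDegree := by
  classical
  let red : (σ →₀ ℕ) → (σ →₀ ℕ) := fun m => m.mapRange (min 1) (by simp)
  let Q : MvPolynomial σ (ZMod 2) := ∑ m ∈ P.support, MvPolynomial.monomial (red m) (P.coeff m)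
  have hQ : IsReducedPoly Q := by
    intro j
    refine (MvPolynomial.degreeOf_sum_le j _ _).trans (Finset.sup_le fun m hm => ?_)
    rw [MvPolynomial.degreeOf_monomial_eq _ _ (MvPolynomial.mem_support_iff.1 hm)]
    simp [red]
  have hpow : ∀ (a : ZMod 2) (e : ℕ), a ^ min 1 e = a ^ e := by
    intro a e
    rcases e with _ | e
    · simp
    · rw [min_eq_left (by omega)]
      obtain rfl | rfl : a = 0 ∨ a = 1 := by decide +revert
      · simp
      · simp
  have hev : ∀ v, MvPolynomial.eval v Q = MvPolynomial.eval v P := by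
    intro v
    conv_rhs => rw [P.as_sum]
    simp only [Q, map_sum, MvPolynomial.eval_monomial]
    refine Finset.sum_congr rfl fun m _ => ?_
    rw [Finsupp.prod_mapRange_index (by simp)]
    simp only [hpow]
  rw [anf_eq hQ hev]
  refine MvPolynomial.totalDegree_finsetSum_le fun m hm => ?_
  refine (MvPolynomial.totalDegree_monomial_le _ _).trans
    (le_trans ?_ (MvPolynomial.le_totalDegree hm))
  rw [Finsupp.sum_mapRange_index (by simp)]
  exact Finset.sum_le_sum fun i _ => by simp

theorem totalDegree_anf_le_iff {σ : Type} [Finite σ] {d : ℕ} {f : (σ → ZMod 2) → ZMod 2} :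
    (anf f).totalDegree ≤ d ↔ f ∈ degreeLE (σ → ZMod 2) d := by
  have := Fintype.ofFinite σ
  refine ⟨fun h => ?_, fun h => ?_⟩
  · have := eval_mem_degreeLE h
    rwa [funext (anf_spec f).2] at this
  · obtain ⟨P, hP, hPf⟩ := exists_eval_of_mem_degreeLE h
    rw [← funext hPf]
    exact (totalDegree_anf_eval_le P).trans hP

theorem algDegree_le_iff {K L : Type*} [Field K] [Algebra (ZMod 2) K]
    [Field L] [Algebra (ZMod 2) L] {σ ρ : Type} [Finite σ] [Fintype ρ]
    (b : Module.Basis σ (ZMod 2) K) (c : Module.Basis ρ (ZMod 2) L) (H : K → L) (d : ℕ) :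
    algDegree b c H ≤ d ↔ ∀ j, (fun x => c.coord j (H x)) ∈ degreeLE K d := by
  simp only [algDegree, Finset.sup_le_iff, Finset.mem_univ, true_implies, totalDegree_anf_le_iff]
  refine forall_congr' fun j => ⟨fun h => ?_, fun h => ?_⟩
  · simpa [-Module.Basis.equivFun_apply] using
      comp_mem_degreeLE (b.equivFun : K →ₗ[ZMod 2] σ → ZMod 2) h
  · simpa using comp_mem_degreeLE (b.equivFun.symm : (σ → ZMod 2) →ₗ[ZMod 2] K) h

/-- Composition with a surjective linear map does not lower the degree of a reduced polynomial:
restrict to the image of a linear section. -/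
theorem totalDegree_le_of_comp_mem_degreeLE {σ : Type} [Finite σ] {P : MvPolynomial σ (ZMod 2)}
    (hP : IsReducedPoly P) {A : V →ₗ[ZMod 2] σ → ZMod 2} (hA : Function.Surjective A) {d : ℕ}
    (h : (fun x => MvPolynomial.eval (A x) P) ∈ degreeLE V d) : P.totalDegree ≤ d := by
  obtain ⟨B, hB⟩ := A.exists_rightInverse_of_surjective (LinearMap.range_eq_top.2 hA)
  have hAB : ∀ v, A (B v) = v := fun v => congrArg (· v) hB
  have h' := comp_mem_degreeLE B h
  simp only [hAB] at h'
  rw [← totalDegree_anf_le_iff, anf_eq hP fun _ => rfl] at h'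
  exact h'

end degreeLE

/-! ### Maiorana–McFarland functions are bent -/

theorem boolSign_add (a b : ZMod 2) : boolSign (a + b) = boolSign a * boolSign b := by
  decide +revert

theorem abs_boolSign (a : ZMod 2) : |boolSign a| = 1 := by
  decide +revert

/-- Orthogonality of the additive characters of `L`. -/
theorem sum_boolSign_trace_mul {L : Type*} [Field L] [Fintype L] [DecidableEq L]
    [Algebra (ZMod 2) L] (z : L) :
    ∑ s : L, boolSign (Algebra.trace (ZMod 2) L (s * z)) =
      if z = 0 then (Fintype.card L : ℤ) else 0 := by
  split_ifs with hz
  · simp [hz, boolSign]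
  · obtain ⟨t, ht⟩ := Algebra.trace_surjective (ZMod 2) L 1
    -- Translating `s` by `t / z` changes every sign.
    have h : ∑ s : L, boolSign (Algebra.trace (ZMod 2) L (s * z)) =
        ∑ s : L, -boolSign (Algebra.trace (ZMod 2) L (s * z)) := by
      refine (Fintype.sum_equiv (Equiv.addRight (t * z⁻¹)) _ _ fun s => ?_)
      have hs : (s + t * z⁻¹) * z = s * z + t := by field_simp
      rw [Equiv.coe_addRight, hs, map_add, ht, boolSign_add]
      simp [boolSign, ZMod.val_one]
    rw [Finset.sum_neg_distrib] at h
    omega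

/-- A function which, in coordinates `(s, y) ∈ L²` on the quadratic extension `K`, has the shape
`Tr(s π(y)) + φ(y)` with `π` a permutation of `L` is bent. The coordinates have to be such that
`x ↦ Tr(a x)` is of the form `Tr(s α) + Tr(y β)`. -/
theorem isBent_maioranaMcFarland {K L : Type*} [Field K] [Fintype K] [Algebra (ZMod 2) K]
    [Field L] [Fintype L] [Algebra (ZMod 2) L] (hrank : Module.finrank (ZMod 2) K =
      2 * Module.finrank (ZMod 2) L) (E : K ≃ L × L)
    (hE : ∀ a : K, ∃ α β : L, ∀ x, Algebra.trace (ZMod 2) K (a * x) =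
      Algebra.trace (ZMod 2) L ((E x).1 * α) + Algebra.trace (ZMod 2) L ((E x).2 * β))
    (π : L → L) (hπ : Function.Bijective π) (φ : L → ZMod 2) (f : K → ZMod 2)
    (hf : ∀ x, f x = Algebra.trace (ZMod 2) L ((E x).1 * π (E x).2) + φ (E x).2) :
    IsBent f := by
  classical
  intro a
  obtain ⟨α, β, hαβ⟩ := hE a
  let ψ : L → ZMod 2 := fun y => φ y + Algebra.trace (ZMod 2) L (y * β)
  obtain ⟨y₀, hy₀⟩ := hπ.2 (-α)
  have h : walsh f a = boolSign (ψ y₀) * Fintype.card L := by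
    calc walsh f a = ∑ p : L × L, boolSign (ψ p.2) *
          boolSign (Algebra.trace (ZMod 2) L (p.1 * (π p.2 + α))) := by
          refine Fintype.sum_equiv E _ _ fun x => ?_
          rw [hf, hαβ, ← boolSign_add, mul_add, map_add]
          congr 1
          simp only [ψ]
          ring
      _ = ∑ y : L, boolSign (ψ y) * if π y + α = 0 then (Fintype.card L : ℤ) else 0 := by
          rw [Fintype.sum_prod_type_right]
          simp_rw [← Finset.mul_sum, sum_boolSign_trace_mul]
      _ = _ := by
          rw [Finset.sum_eq_single y₀]
          · simp [hy₀]
          · intro y _ hy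
            rw [if_neg, mul_zero]
            intro h0
            exact hy (hπ.1 (by rw [hy₀, eq_neg_of_add_eq_zero_left h0]))
          · simp
  rw [h, Int.cast_mul, abs_mul, ← Int.cast_abs, abs_boolSign, hrank,
    Module.card_eq_pow_finrank (K := ZMod 2) (V := L), ZMod.card]
  push_cast
  rw [mul_div_cancel_left₀ _ two_ne_zero, Real.rpow_natCast]
  simp

/-! ### Coordinates on the quadratic extension -/

section Coordinates

variable {K L : Type*} [Field K] [Fintype K] [Field L] [Fintype L] [Algebra L K]

theorem algebraMap_trace_of_finrank_eq_two (h2 : Module.finrank L K = 2) (x : K) :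
    algebraMap L K (Algebra.trace L K x) = x + x ^ Fintype.card L := by
  rw [FiniteField.algebraMap_trace_eq_sum_pow, h2]
  simp [Finset.sum_range_succ]

omit [Fintype L] in
theorem trace_algebraMap_eq_zero [CharP L 2] (h2 : Module.finrank L K = 2) (s : L) :
    Algebra.trace L K (algebraMap L K s) = 0 := by
  rw [Algebra.trace_algebraMap, h2, two_nsmul, CharTwo.add_self_eq_zero]

/-- With `tr_{K/L}(θ) = 1`, every `x ∈ K` is `s + y θ` with `s = tr_{K/L}((θ + 1) x)` and
`y = tr_{K/L}(x)`; this is the resulting bijection `x ↦ (s, y)`. -/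
noncomputable def quadCoord [CharP K 2] [CharP L 2] (h2 : Module.finrank L K = 2) (θ : K)
    (hθ : Algebra.trace L K θ = 1) : K ≃ L × L where
  toFun x := (Algebra.trace L K ((θ + 1) * x), Algebra.trace L K x)
  invFun p := algebraMap L K p.1 + algebraMap L K p.2 * θ
  left_inv x := by
    have h := algebraMap_trace_of_finrank_eq_two h2 θ
    rw [hθ, map_one] at h
    have h' : θ ^ Fintype.card L = θ + 1 := by
      rw [h, ← add_assoc, CharTwo.add_self_eq_zero, zero_add]
    have hadd : (θ + 1) ^ Fintype.card L = θ := by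
      have h1 := algebraMap_trace_of_finrank_eq_two h2 (θ + 1)
      rw [map_add, hθ, ← map_one (algebraMap L K), trace_algebraMap_eq_zero h2, add_zero,
        map_one] at h1
      linear_combination -h1 - θ * CharTwo.two_eq_zero (R := K)
    simp only [algebraMap_trace_of_finrank_eq_two h2, mul_pow, hadd]
    linear_combination (x * θ + x ^ Fintype.card L * θ) * (CharTwo.two_eq_zero (R := K))
  right_inv p := by
    have hsq : Algebra.trace L K (θ * θ) = 1 := by
      apply (algebraMap L K).injective
      have h := algebraMap_trace_of_finrank_eq_two h2 θ
      rw [hθ, map_one] at h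
      have h' : θ ^ Fintype.card L = 1 - θ := by rw [h]; ring
      rw [algebraMap_trace_of_finrank_eq_two h2, mul_pow, h', map_one]
      linear_combination (θ * θ - θ) * CharTwo.two_eq_zero (R := K)
    have hl : ∀ (a : L) (x : K), Algebra.trace L K (algebraMap L K a * x) =
        a * Algebra.trace L K x := fun a x => by
      rw [← Algebra.smul_def, map_smul, smul_eq_mul]
    have e : (θ + 1) * (algebraMap L K p.1 + algebraMap L K p.2 * θ) =
        algebraMap L K p.1 * θ + algebraMap L K p.1 + algebraMap L K p.2 * (θ * θ)
          + algebraMap L K p.2 * θ := by ring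
    ext
    · simp [e, hl, hsq, hθ, trace_algebraMap_eq_zero h2, add_assoc, CharTwo.add_self_eq_zero]
    · simp [hl, hθ, trace_algebraMap_eq_zero h2]

end Coordinates

/-! ### The Niho sum in coordinates -/

/-- The conjugation `x ↦ x^(2^k)` pairs the terms of the sum: with `A = x^(2^k 2^(k-r))` and
`B = x^(2^(k-r))` the terms are `A^i B^(2^r-i)`, and `A^(2^r) = x`, `B^(2^r) = x^(2^k)`, so that
summing the geometric progression gives this identity. -/
theorem nihoSum_mul {K : Type*} [Field K] [Fintype K] {k r : ℕ} (hrk : r ≤ k)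
    (hK : Fintype.card K = 2 ^ (2 * k)) (x : K) :
    nihoSum k r x * ((x ^ 2 ^ k) ^ 2 ^ (k - r) - x ^ 2 ^ (k - r)) =
      x * x ^ 2 ^ (k - r) - x ^ 2 ^ k * (x ^ 2 ^ k) ^ 2 ^ (k - r) := by
  obtain ⟨m, rfl⟩ := Nat.exists_eq_add_of_le hrk
  rw [Nat.add_sub_cancel_left]
  have hx : (x ^ 2 ^ (r + m)) ^ 2 ^ (r + m) = x := by
    rw [← pow_mul, ← pow_add, ← two_mul, ← hK, FiniteField.pow_card]
  have hA : ((x ^ 2 ^ (r + m)) ^ 2 ^ m) ^ 2 ^ r = x := by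
    rw [← pow_mul, ← pow_add, add_comm m r, hx]
  have hB : (x ^ 2 ^ m) ^ 2 ^ r = x ^ 2 ^ (r + m) := by
    rw [← pow_mul, ← pow_add, add_comm m r]
  set A := (x ^ 2 ^ (r + m)) ^ 2 ^ m with hAdef
  set B := x ^ 2 ^ m with hBdef
  obtain ⟨N, hN⟩ : ∃ N, 2 ^ r = N + 1 := Nat.exists_eq_succ_of_ne_zero (by positivity)
  have hs : nihoSum (r + m) r x = A * B * ∑ i ∈ Finset.range N, A ^ i * B ^ (N - 1 - i) := by
    rw [nihoSum, hN, Nat.add_sub_cancel, ← Finset.Ico_add_one_right_eq_Icc,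
      Finset.sum_Ico_eq_sum_range,
      Nat.add_sub_cancel, Finset.mul_sum]
    refine Finset.sum_congr rfl fun i hi => ?_
    obtain ⟨j, rfl⟩ := Nat.exists_eq_add_of_lt (Finset.mem_range.1 hi)
    have e1 : A * B * (A ^ i * B ^ (i + j + 1 - 1 - i)) = A ^ (1 + i) * B ^ (j + 1) := by
      rw [show i + j + 1 - 1 - i = j by omega]; ring
    rw [e1, hAdef, hBdef, ← pow_mul, ← pow_mul, ← pow_mul, ← pow_add, Nat.add_sub_cancel_left]
    congr 1
    obtain ⟨M, hM⟩ : ∃ M, 2 ^ (r + m) = M + 1 := Nat.exists_eq_succ_of_ne_zero (by positivity)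
    have h2 : 2 ^ (r + m) = (i + j + 1 + 1) * 2 ^ m := by rw [pow_add, hN]
    rw [hM] at h2 ⊢
    rw [Nat.add_sub_cancel]
    have : ((1 + i) * 2 ^ m + 1) * M + 1 = (1 + i) * 2 ^ m * M + (M + 1) := by ring
    rw [this]
    linarith
  have hg := (Commute.all A B).geom_sum₂_mul N
  rw [hs, mul_assoc, hg]
  rw [hN, pow_succ] at hA hB
  linear_combination B * hA - A * hB

theorem nihoSum_zero {K : Type*} [Field K] (k r : ℕ) : nihoSum k r (0 : K) = 0 := by
  simp [nihoSum]

/-- On the subfield every term of the sum equals `x`, and their number is odd. -/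
theorem nihoSum_of_pow_eq {K : Type*} [Field K] [CharP K 2] {k r : ℕ} (hr : r ≠ 0) {x : K}
    (hx : x ^ 2 ^ k = x) : nihoSum k r x = x := by
  rcases eq_or_ne x 0 with rfl | h0
  · exact nihoSum_zero k r
  have h1 : x ^ (2 ^ k - 1) = 1 := by
    apply mul_right_cancel₀ h0
    rw [← pow_succ, Nat.sub_add_cancel Nat.one_le_two_pow, hx, one_mul]
  have hterm : ∀ i, x ^ ((i * 2 ^ (k - r) + 1) * (2 ^ k - 1) + 1) = x := fun i => by
    rw [pow_succ, mul_comm _ (2 ^ k - 1), pow_mul, h1, one_pow, one_mul]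
  rw [nihoSum]
  simp only [hterm]
  rw [Finset.sum_const, Nat.card_Icc, Nat.add_sub_cancel, nsmul_eq_mul,
    Nat.cast_sub Nat.one_le_two_pow]
  have h2 : (2 : K) = 0 := CharTwo.two_eq_zero
  push_cast
  rw [h2, zero_pow hr]
  linear_combination (-x) * h2

/-- The coordinate form of the Niho sum: with `x = s + y θ` it is
`s + (y^(2^r-1) s)^(2^(k-r)) + tr(θ^(2^(k-r)+1)) y`, which is `𝔽₂`-affine in `s` for fixed `y`. -/
theorem nihoSum_eq {K L : Type*} [Field K] [Fintype K] [Field L] [Fintype L] [Algebra L K]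
    [CharP K 2] [CharP L 2] {k r : ℕ} (hr : 1 ≤ r) (hrk : r ≤ k)
    (hK : Fintype.card K = 2 ^ (2 * k)) (hL : Fintype.card L = 2 ^ k)
    (h2 : Module.finrank L K = 2) (θ : K) (hθ : Algebra.trace L K θ = 1) (s y : L) :
    nihoSum k r (algebraMap L K s + algebraMap L K y * θ) =
      algebraMap L K (s + (y ^ (2 ^ r - 1) * s) ^ 2 ^ (k - r) +
        Algebra.trace L K (θ ^ (2 ^ (k - r) + 1)) * y) := by
  have hQ : 2 ^ r - 1 ≠ 0 := by
    have : 2 ^ 1 ≤ 2 ^ r := Nat.pow_le_pow_right (by norm_num) hr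
    omega
  rcases eq_or_ne y 0 with rfl | hy
  · rw [nihoSum_of_pow_eq (by omega)]
    · simp [hQ]
    · simp only [map_zero, zero_mul, add_zero]
      rw [← map_pow, ← hL, FiniteField.pow_card]
  set x := algebraMap L K s + algebraMap L K y * θ with hx
  set q := 2 ^ (k - r) with hq
  have htr := fun z : K => algebraMap_trace_of_finrank_eq_two h2 z
  rw [hL] at htr
  have two : (2 : K) = 0 := CharTwo.two_eq_zero
  have hl : ∀ (a : L) (x : K), Algebra.trace L K (algebraMap L K a * x) =
      a * Algebra.trace L K x := fun a x => by
    rw [← Algebra.smul_def, map_smul, smul_eq_mul]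
  have hy1 : Algebra.trace L K x = y := by
    simp [hx, hl, hθ, trace_algebraMap_eq_zero h2]
  have hxbar : x ^ 2 ^ k = algebraMap L K y - x := by
    rw [← hy1, htr]; ring
  have hden : (x ^ 2 ^ k) ^ q - x ^ q = algebraMap L K (y ^ q) := by
    rw [hxbar, hq, sub_pow_char_pow, map_pow]
    linear_combination (-x ^ 2 ^ (k - r)) * two
  have hq' : x ^ q = algebraMap L K (s ^ q) + algebraMap L K (y ^ q) * θ ^ q := by
    rw [hx, hq, add_pow_char_pow, mul_pow, map_pow, map_pow]
  have hnum : x * x ^ q - x ^ 2 ^ k * (x ^ 2 ^ k) ^ q = algebraMap L K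
      (s ^ q * y + y ^ q * s + y ^ q * y * Algebra.trace L K (θ ^ (q + 1))) := by
    have e : x * x ^ q = algebraMap L K (s ^ q * s) + algebraMap L K (s ^ q * y) * θ +
        algebraMap L K (y ^ q * s) * θ ^ q + algebraMap L K (y ^ q * y) * θ ^ (q + 1) := by
      rw [hq', hx]
      simp only [map_mul]
      ring
    have hθq : Algebra.trace L K (θ ^ q) = 1 := by
      apply (algebraMap L K).injective
      have h := htr θ
      rw [hθ, map_one] at h
      rw [htr, map_one, ← pow_mul, mul_comm, pow_mul, hq, ← add_pow_char_pow, ← h, one_pow]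
    have : x * x ^ q - x ^ 2 ^ k * (x ^ 2 ^ k) ^ q =
        algebraMap L K (Algebra.trace L K (x * x ^ q)) := by
      rw [htr, mul_pow, ← pow_mul, ← pow_mul, mul_comm q]
      linear_combination (-(x ^ 2 ^ k * x ^ (2 ^ k * q))) * two
    rw [this, e]
    simp only [map_add (Algebra.trace L K), hl, hθ, hθq, trace_algebraMap_eq_zero h2]
    congr 1
    ring
  have hmain := nihoSum_mul hrk hK x
  rw [← hq, hden, hnum] at hmain
  have hyq : algebraMap L K (y ^ q) ≠ 0 := by simpa using pow_ne_zero q hy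
  apply mul_right_cancel₀ hyq
  rw [hmain, ← map_mul]
  congr 1
  have hyy : (y ^ (2 ^ r - 1)) ^ q * y ^ q = y := by
    rw [← mul_pow, ← pow_succ, Nat.sub_add_cancel Nat.one_le_two_pow, ← pow_mul, hq, ← pow_add,
      Nat.add_sub_cancel' hrk, ← hL, FiniteField.pow_card]
  rw [mul_pow]
  linear_combination (-s ^ q) * hyy

/-! ### Powers and traces in characteristic two -/

section Powers

variable {L : Type*} [Field L] [Fintype L] [Algebra (ZMod 2) L]

/-- The iterated Frobenius `y ↦ y^(2^j)` as an `𝔽₂`-linear map. -/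
noncomputable def frobeniusLinear (L : Type*) [Field L] [Algebra (ZMod 2) L] [CharP L 2] (j : ℕ) :
    L →ₗ[ZMod 2] L :=
  (iterateFrobenius L 2 j).toAddMonoidHom.toZModLinearMap 2

theorem frobeniusLinear_apply {L : Type*} [Field L] [Algebra (ZMod 2) L] [CharP L 2] (j : ℕ)
    (y : L) : frobeniusLinear L j y = y ^ 2 ^ j := rfl

/-- The absolute trace is invariant under Frobenius. -/
theorem trace_pow_two_pow (z : L) (j : ℕ) :
    Algebra.trace (ZMod 2) L (z ^ 2 ^ j) = Algebra.trace (ZMod 2) L z := by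
  induction j with
  | zero => simp
  | succ j ih =>
    rw [pow_succ, pow_mul, ← ih]
    have h := Algebra.trace_eq_of_algEquiv
      (FiniteField.frobeniusAlgEquivOfAlgebraic (ZMod 2) L) (z ^ 2 ^ j)
    simpa [ZMod.card] using h

omit [Algebra (ZMod 2) L] in
/-- The exponent `2^r - 1` is coprime to `2^k - 1`, the order of the multiplicative group. -/
theorem pow_two_pow_sub_one_injective {k r : ℕ} (hcop : Nat.gcd r k = 1) (hr : 1 ≤ r)
    (hL : Fintype.card L = 2 ^ k) : Function.Injective fun y : L => y ^ (2 ^ r - 1) := by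
  classical
  have hQ : 2 ^ r - 1 ≠ 0 := by
    have : 2 ^ 1 ≤ 2 ^ r := Nat.pow_le_pow_right (by norm_num) hr
    omega
  intro y z h
  simp only at h
  rcases eq_or_ne y 0 with rfl | hy
  · rw [zero_pow hQ] at h
    exact (pow_eq_zero_iff hQ |>.1 h.symm).symm
  · have hz : z ≠ 0 := by
      rintro rfl
      rw [zero_pow hQ] at h
      exact hy ((pow_eq_zero_iff hQ).1 h)
    have hc : (Nat.card Lˣ).Coprime (2 ^ r - 1) := by
      rw [Nat.card_units, Nat.card_eq_fintype_card, hL, Nat.coprime_iff_gcd_eq_one,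
        Nat.pow_sub_one_gcd_pow_sub_one, Nat.gcd_comm, hcop, pow_one]
    have h' : powCoprime hc (Units.mk0 y hy) = powCoprime hc (Units.mk0 z hz) := by
      ext
      simpa using h
    simpa using (powCoprime hc).injective h'

omit [Algebra (ZMod 2) L] in
theorem bijective_add_mul_pow {k r : ℕ} (hcop : Nat.gcd r k = 1) (hr : 1 ≤ r)
    (hL : Fintype.card L = 2 ^ k) {c d : L} (hd : d ≠ 0) :
    Function.Bijective fun y : L => c + d * y ^ (2 ^ r - 1) := by
  refine Finite.injective_iff_bijective.1 fun y z h => ?_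
  exact pow_two_pow_sub_one_injective hcop hr hL (mul_left_cancel₀ hd (add_left_cancel h))

/-- The power `y^(2^r-1)` is the product of the `r` linear maps `y^(2^j)`, `j < r`. -/
theorem linear_pow_mul_mem_degreeLE {V : Type*} [AddCommGroup V] [Module (ZMod 2) V] [CharP L 2]
    (S Y : V →ₗ[ZMod 2] L) (r : ℕ) (T : L →ₗ[ZMod 2] ZMod 2) :
    (fun x => T (Y x ^ (2 ^ r - 1) * S x)) ∈ degreeLE V (r + 1) := by
  induction r generalizing T with
  | zero => simpa using! linear_mem_degreeLE (T ∘ₗ S)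
  | succ r ih =>
    have h := linear_mul_comp_mem_degreeLE (frobeniusLinear L r ∘ₗ Y) ih T
    have e : 2 ^ (r + 1) - 1 = 2 ^ r + (2 ^ r - 1) := by
      have : 1 ≤ 2 ^ r := Nat.one_le_two_pow
      rw [pow_succ]; omega
    rw [e]
    simpa [frobeniusLinear_apply, pow_add _ (2 ^ r), mul_assoc] using h

end Powers

/-- The functionals `x ↦ Tr(u_{i_j} x) = Tr(u_{i_j} tr_{K/L}(x))` on `K` are independent, since the
relative trace is onto and the `u_m` have a dual basis for the trace form of `L`. -/
theorem surjective_trace_mul_basis {K L : Type*} [Field K] [Finite K] [Field L] [Finite L]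
    [Algebra (ZMod 2) K] [Algebra (ZMod 2) L] [Algebra L K] [IsScalarTower (ZMod 2) L K]
    {ι κ : Type} [Fintype ι] [Finite κ] (u : Module.Basis ι (ZMod 2) L) {i : κ → ι}
    (hi : Function.Injective i) :
    Function.Surjective (LinearMap.pi fun j =>
      Algebra.trace (ZMod 2) K ∘ₗ LinearMap.mulLeft (ZMod 2) (algebraMap L K (u (i j))) :
        K →ₗ[ZMod 2] κ → ZMod 2) := by
  classical
  intro v
  let B := Algebra.traceForm (ZMod 2) L
  have hB : B.Nondegenerate := traceForm_nondegenerate (ZMod 2) L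
  let w : ι → ZMod 2 := Function.extend i v 0
  obtain ⟨x, hx⟩ := Algebra.trace_surjective L K (∑ m, w m • B.dualBasis hB u m)
  refine ⟨x, funext fun j => ?_⟩
  have h : Algebra.trace (ZMod 2) L (u (i j) * ∑ m, w m • B.dualBasis hB u m) = w (i j) := by
    have hsymm : B.IsSymm := Algebra.traceForm_isSymm (ZMod 2)
    have hd : ∀ m, Algebra.trace (ZMod 2) L (u (i j) * B.dualBasis hB u m) =
        if m = i j then 1 else 0 := fun m => by
      rw [mul_comm, ← Algebra.traceForm_apply, LinearMap.BilinForm.apply_dualBasis_left]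
      simp [eq_comm]
    simp [Finset.mul_sum, hd]
  simp only [LinearMap.pi_apply, LinearMap.comp_apply, LinearMap.mulLeft_apply]
  rw [← Algebra.trace_trace (S := L), ← Algebra.smul_def, map_smul, smul_eq_mul, hx, h]
  exact hi.extend_apply v 0 j

/-! ### The vectorial bent function -/

/-- `Tr(x) = Tr(tr_{K/L}(x))` puts the characters of `K` into the shape required by
`isBent_maioranaMcFarland`. -/
theorem trace_mul_quadCoord {K L : Type*} [Field K] [Fintype K] [Field L] [Fintype L]
    [Algebra (ZMod 2) K] [Algebra (ZMod 2) L] [Algebra L K] [IsScalarTower (ZMod 2) L K]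
    [CharP K 2] [CharP L 2] (h2 : Module.finrank L K = 2) (θ : K)
    (hθ : Algebra.trace L K θ = 1) (a x : K) :
    Algebra.trace (ZMod 2) K (a * x) =
      Algebra.trace (ZMod 2) L ((quadCoord h2 θ hθ x).1 * Algebra.trace L K a) +
        Algebra.trace (ZMod 2) L ((quadCoord h2 θ hθ x).2 * Algebra.trace L K (a * θ)) := by
  conv_lhs => rw [← (quadCoord h2 θ hθ).symm_apply_apply x]
  set p := quadCoord h2 θ hθ x
  have e : a * (quadCoord h2 θ hθ).symm p = p.1 • a + p.2 • (a * θ) := by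
    change a * (algebraMap L K p.1 + algebraMap L K p.2 * θ) = _
    rw [Algebra.smul_def, Algebra.smul_def]
    ring
  rw [e, ← Algebra.trace_trace (S := L)]
  simp only [map_add, map_smul, smul_eq_mul]

theorem theorem6 {k r : ℕ} (hr : 1 < r) (hrk : r < k) (hcop : Nat.gcd r k = 1)
    {K L : Type*} [Field K] [Fintype K] [Field L] [Fintype L]
    [Algebra (ZMod 2) K] [Algebra (ZMod 2) L] [Algebra L K]
    (hK : Fintype.card K = 2 ^ (2 * k)) (hL : Fintype.card L = 2 ^ k) :
    ∃ G : K → L, (∀ x : K, algebraMap L K (G x) = nihoSum k r x) ∧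
      ∀ (u : Module.Basis (Fin k) (ZMod 2) L) (τ : ℕ) (i : Fin τ → Fin k)
        (_ : Function.Injective i) (F : MvPolynomial (Fin τ) (ZMod 2)) (_ : IsReducedPoly F)
        (H : K → L)
        (_ : ∀ x : K, H x = G x + algebraMap (ZMod 2) L (MvPolynomial.eval
          (fun j => Algebra.trace (ZMod 2) K (algebraMap L K (u (i j)) * x)) F)),
        IsVectorialBent H ∧
          ∀ (b : Module.Basis (Fin (2 * k)) (ZMod 2) K) (c : Module.Basis (Fin k) (ZMod 2) L),
            F.totalDegree = k → algDegree b c G ≠ k → algDegree b c H = k := by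
  have : CharP K 2 := charP_of_injective_algebraMap (algebraMap (ZMod 2) K).injective 2
  have : CharP L 2 := charP_of_injective_algebraMap (algebraMap (ZMod 2) L).injective 2
  have : IsScalarTower (ZMod 2) L K :=
    IsScalarTower.of_algebraMap_eq' (Subsingleton.elim _ _)
  have h2 : Module.finrank L K = 2 := by
    have h := Module.card_eq_pow_finrank (K := L) (V := K)
    rw [hK, hL, ← pow_mul, mul_comm 2] at h
    exact (Nat.eq_of_mul_eq_mul_left (by omega) (Nat.pow_right_injective le_rfl h)).symm
  obtain ⟨θ, hθ⟩ := Algebra.trace_surjective L K 1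
  let C : L := Algebra.trace L K (θ ^ (2 ^ (k - r) + 1))
  -- The coordinates `s` and `y` as `𝔽₂`-linear maps.
  let Y : K →ₗ[ZMod 2] L := (Algebra.trace L K).restrictScalars (ZMod 2)
  let S : K →ₗ[ZMod 2] L := Y ∘ₗ LinearMap.mulLeft (ZMod 2) (θ + 1)
  let G : K → L := fun x => S x + (Y x ^ (2 ^ r - 1) * S x) ^ 2 ^ (k - r) + C * Y x
  refine ⟨G, fun x => ?_, ?_⟩
  · have h := nihoSum_eq hr.le hrk.le hK hL h2 θ hθ (S x) (Y x)
    rw [show algebraMap L K (S x) + algebraMap L K (Y x) * θ = x from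
      (quadCoord h2 θ hθ).symm_apply_apply x] at h
    exact h.symm
  intro u τ i hi F hF H hH
  refine ⟨fun c hc => ?_, fun b c hFk hGk => ?_⟩
  · refine isBent_maioranaMcFarland ?_ (quadCoord h2 θ hθ)
      (fun a => ⟨_, _, trace_mul_quadCoord h2 θ hθ a⟩)
      (fun y => c + c ^ 2 ^ r * y ^ (2 ^ r - 1))
      (bijective_add_mul_pow hcop hr.le hL (pow_ne_zero _ hc))
      (fun y => Algebra.trace (ZMod 2) L (c * (C * y) + c * algebraMap (ZMod 2) L
        (MvPolynomial.eval (fun j => Algebra.trace (ZMod 2) L (u (i j) * y)) F))) _ fun x => ?_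
    · rw [← Module.finrank_mul_finrank (ZMod 2) L K, h2, mul_comm]
    · have hu : ∀ v : L, Algebra.trace (ZMod 2) K (algebraMap L K v * x) =
          Algebra.trace (ZMod 2) L (v * Y x) := fun v => by
        rw [← Algebra.trace_trace (S := L), ← Algebra.smul_def, map_smul, smul_eq_mul]
        rfl
      -- `Tr(c z^(2^(k-r))) = Tr(c^(2^r) z)`, because `c = (c^(2^r))^(2^(k-r))`.
      have hpow : Algebra.trace (ZMod 2) L (c * (Y x ^ (2 ^ r - 1) * S x) ^ 2 ^ (k - r)) =
          Algebra.trace (ZMod 2) L (c ^ 2 ^ r * (Y x ^ (2 ^ r - 1) * S x)) := by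
        rw [← trace_pow_two_pow (c ^ 2 ^ r * _) (k - r), mul_pow (c ^ 2 ^ r), ← pow_mul c, ← pow_add,
          Nat.add_sub_cancel' hrk.le, ← hL, FiniteField.pow_card]
      change Algebra.trace (ZMod 2) L (c * H x) = Algebra.trace (ZMod 2) L
        (S x * (c + c ^ 2 ^ r * Y x ^ (2 ^ r - 1))) + Algebra.trace (ZMod 2) L
          (c * (C * Y x) + c * algebraMap (ZMod 2) L
            (MvPolynomial.eval (fun j => Algebra.trace (ZMod 2) L (u (i j) * Y x)) F))
      have e : S x * (c + c ^ 2 ^ r * Y x ^ (2 ^ r - 1)) =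
          c * S x + c ^ 2 ^ r * (Y x ^ (2 ^ r - 1) * S x) := by ring
      rw [hH, e]
      simp only [hu, G, mul_add, map_add, hpow]
      ring
  · have hdegG : ∀ j, (fun x => c.coord j (G x)) ∈ degreeLE K k := fun j => by
      have h1 := degreeLE_mono (show 1 ≤ k by omega) (linear_mem_degreeLE (c.coord j ∘ₗ S))
      have h3 := degreeLE_mono (show 1 ≤ k by omega)
        (linear_mem_degreeLE (c.coord j ∘ₗ LinearMap.mulLeft (ZMod 2) C ∘ₗ Y))
      have h2 := degreeLE_mono (show r + 1 ≤ k by omega)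
        (linear_pow_mul_mem_degreeLE S Y r (c.coord j ∘ₗ frobeniusLinear L (k - r)))
      convert add_mem (add_mem h1 h2) h3 using 1
      ext x
      simp [G, frobeniusLinear_apply]
    let A : K →ₗ[ZMod 2] Fin τ → ZMod 2 := LinearMap.pi fun j =>
      Algebra.trace (ZMod 2) K ∘ₗ LinearMap.mulLeft (ZMod 2) (algebraMap L K (u (i j)))
    have hA : Function.Surjective A := surjective_trace_mul_basis u hi
    have hHj : ∀ j, (fun x => c.coord j (H x)) = (fun x => c.coord j (G x)) +
        c.coord j 1 • fun x => MvPolynomial.eval (A x) F := fun j => by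
      ext x
      rw [hH, map_add, Algebra.algebraMap_eq_smul_one, map_smul, Pi.add_apply, Pi.smul_apply,
        smul_eq_mul, smul_eq_mul, mul_comm (c.coord j 1)]
      rfl
    refine le_antisymm ?_ ?_
    · refine (algDegree_le_iff b c H k).2 fun j => ?_
      rw [hHj]
      exact add_mem (hdegG j)
        (Submodule.smul_mem _ _ (comp_mem_degreeLE A (eval_mem_degreeLE hFk.le)))
    · -- Otherwise the coordinates of both `G` and `H` would have degree below `k`, and so would
      -- `F ∘ A`, which is the difference of two of them because some coordinate of `1` is `1`.
      by_contra! hlt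
      have hGle := (algDegree_le_iff b c G k).2 hdegG
      have hG' := (algDegree_le_iff b c G (k - 1)).1 (by omega)
      have hH' := (algDegree_le_iff b c H (k - 1)).1 (by omega)
      obtain ⟨j, hj⟩ : ∃ j, c.coord j 1 ≠ 0 := by
        by_contra! h0
        exact one_ne_zero ((c.forall_coord_eq_zero_iff).1 h0)
      have h := sub_mem (hH' j) (hG' j)
      rw [hHj, add_sub_cancel_left, (degreeLE K (k - 1)).smul_mem_iff hj] at h
      have := totalDegree_le_of_comp_mem_degreeLE hF hA h
      omega
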